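/- Let $n\ge 1$. A sequence of natural numbers $(a_1,\dots,a_m)$ is a parking function if its weakly increasing rearrangement $(z_1,\dots,z_m)$ satisfies $z_i\le i-1$ for all $i$. Identify $\mathbb Z_n=\mathbb Z/n\mathbb Z$ with $\{0,\dots,n-1\}$, and let $E_{n,1}$ be the set of all $(x_1,\dots,x_n)\in\mathbb Z_n^n$ such that $(x_1,\dots,x_{n-1})$ is a parking function and $x_1+\dots+x_n\equiv 1 \pmod n$. Let $\tau_{n,1}$ be the action of the symmetric group $S_n$ on $E_{n,1}$ (products of permutations being read from left to right) given by $$\pi\cdot(x_1,\dots,x_n)=(y+x_{\pi_1},\dots,y+x_{\pi_n}),$$ where $y\in\mathbb Z_n$ is the unique element for which $(y+x_{\pi_1},\dots,y+x_{\pi_{n-1}})$ is a parking function. Let $\chi_{n,1}$ be the character of the associated complex permutation representation. For every $\pi\in S_n$ with cycle type $\lambda=(\lambda_1,\dots,\lambda_\ell)$ (fixed points counted as parts equal to $1$) and $d=\gcd(\lambda_1,\dots,\lambda_\ell)$, $$\chi_{n,1}(\pi)=\begin{cases} n^{\ell-2} & \text{if } d=1,\\ 2n^{\ell-2} & \text{if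 } d=2 \text{ and } n\equiv 2 \pmod 4,\\ 0 & \text{otherwise.}\end{cases}$$ Moreover, the number of orbits of $\tau_{n,1}$ is $$o_{n,1}=\frac1{n^2}\sum_{d\mid n}(-1)^{n+d}\,\mu(n/d)\binom{2d-1}{d},$$ where $\mu$ is the Möbius function. -/

import Mathlib

open Finset

/-- A sequence `a = (a_1, …, a_m)` of natural numbers is a parking function if its weakly increasing
rearrangement `z` satisfies `z_i ≤ i - 1` for `i = 1, …, m` (here the positions are numbered from
`0`, so that the bound reads `z_i ≤ i`). -/
def IsParkingFunction {m : ℕ} (a : Fin m → ℕ) : Prop :=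
  ∀ i : Fin m, (a ∘ Tuple.sort a) i ≤ (i : ℕ)

/-- The residues `x_1, …, x_{n-1}`, as integers in `{0, …, n-1}`. -/
def initialResidues {n : ℕ} (x : Fin n → ZMod n) : Fin (n - 1) → ℕ :=
  fun i => (x (Fin.castLE (Nat.sub_le n 1) i)).val

/-- The set of sequences `(x_1, …, x_n)` in `(ℤ/nℤ)^n` such that `(x_1, …, x_{n-1})` is a parking
function and `x_1 + ⋯ + x_n = c` modulo `n`. -/
def ExtParkingFunction (n c : ℕ) : Type :=
  {x : Fin n → ZMod n // IsParkingFunction (initialResidues x) ∧ ∑ i, x i = (c : ZMod n)}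

theorem isParkingFunction_iff {m : ℕ} (a : Fin m → ℕ) :
    IsParkingFunction a ↔ ∀ k ≤ m, k ≤ #{i | a i < k} := by
  have hcard : ∀ k, #{i | a i < k} = #{i | a (Tuple.sort a i) < k} := fun k =>
    (Finset.card_equiv (Tuple.sort a) (by simp)).symm
  constructor
  · intro h k hk
    rw [hcard]
    calc k = #{i : Fin m | (i : ℕ) < k} := by
          rw [Fin.card_filter_val_lt]; omega
      _ ≤ _ := by
          apply Finset.card_le_card
          intro i
          simp only [Finset.mem_filter, Finset.mem_univ, true_and]
          exact fun hi => lt_of_le_of_lt (h i) hi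
  · intro h i
    by_contra! hi
    have h1 := h (i + 1) i.2
    rw [hcard] at h1
    have h2 : #{j | a (Tuple.sort a j) < (i : ℕ) + 1} ≤ #{j : Fin m | (j : ℕ) < i} := by
      apply Finset.card_le_card
      intro j
      simp only [Finset.mem_filter, Finset.mem_univ, true_and]
      intro hj
      by_contra! hij
      have h3 : (a ∘ Tuple.sort a) i ≤ (a ∘ Tuple.sort a) j := Tuple.monotone_sort a hij
      simp only [Function.comp] at h3 hi
      omega
    rw [Fin.card_filter_val_lt] at h2
    omega

theorem isParkingFunction_shift_iff {n m : ℕ} (hm : m + 1 = n) (w : Fin m → ZMod n) (s : ℕ)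
    (P : ℕ → ℤ) (hP : ∀ t, P t = ∑ j ∈ range t, ((#{i | w i = (j : ZMod n)} : ℤ) - 1)) :
    IsParkingFunction (fun i => (-(s : ZMod n) + w i).val) ↔ ∀ k < n, P s ≤ P (s + k) := by
  have : NeZero n := ⟨by omega⟩
  rw [isParkingFunction_iff]
  have key : ∀ k < n, P (s + k) - P s = (#{i | (-(s : ZMod n) + w i).val < k} : ℤ) - k := by
    intro k hk
    rw [hP, hP, Finset.sum_range_add, add_sub_cancel_left, Finset.sum_sub_distrib]
    simp only [Finset.sum_const, Finset.card_range, nsmul_eq_mul, mul_one]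
    congr 1
    rw [Finset.card_eq_sum_card_fiberwise (f := fun i => (-(s : ZMod n) + w i).val) (t := range k)
      (by intro i hi; simpa using hi)]
    push_cast
    refine Finset.sum_congr rfl fun j hj => ?_
    congr 2
    ext i
    simp only [Finset.mem_filter, Finset.mem_univ, true_and]
    have hjk := Finset.mem_range.1 hj
    constructor
    · intro h
      have h1 : (-(s : ZMod n) + w i).val = j := by
        rw [h, neg_add_cancel_left, ZMod.val_natCast_of_lt (by omega)]
      exact ⟨h1 ▸ hjk, h1⟩
    · rintro ⟨-, h⟩
      have h1 := congrArg (Nat.cast (R := ZMod n)) h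
      rw [ZMod.natCast_zmod_val] at h1
      rw [← h1]; ring
  constructor
  · intro h k hk
    have h1 := h k (by omega)
    have h2 := key k hk
    omega
  · intro h k hk
    have h1 := h k (by omega)
    have h2 := key k (by omega)
    omega

theorem existsUnique_shift_aux {n m : ℕ} (hm : m + 1 = n) (w : Fin m → ZMod n) :
    ∃! y : ZMod n, IsParkingFunction (fun i => (y + w i).val) := by
  have : NeZero n := ⟨by omega⟩
  obtain ⟨P, hP⟩ : ∃ P : ℕ → ℤ,
      ∀ t, P t = ∑ j ∈ range t, ((#{i | w i = (j : ZMod n)} : ℤ) - 1) := ⟨_, fun _ => rfl⟩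
  have hiff := fun s => isParkingFunction_shift_iff hm w s P hP
  have hn : P n = -1 := by
    rw [hP, Finset.sum_sub_distrib]
    have h1 : (∑ j ∈ range n, #{i | w i = (j : ZMod n)}) = m := by
      have := Finset.card_eq_sum_card_fiberwise (s := (univ : Finset (Fin m)))
        (f := fun i => (w i).val) (t := range n) (by intro i _; simpa using ZMod.val_lt (w i))
      rw [Finset.card_univ, Fintype.card_fin] at this
      refine Eq.trans ?_ this.symm
      refine Finset.sum_congr rfl fun j hj => ?_
      congr 1
      ext i
      simp only [Finset.mem_filter, Finset.mem_univ, true_and]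
      constructor
      · intro h; rw [h, ZMod.val_natCast_of_lt (Finset.mem_range.1 hj)]
      · intro h; rw [← h, ZMod.natCast_zmod_val]
    rw [← Nat.cast_sum, h1]
    simp
    omega
  have hper : ∀ t, P (t + n) = P t - 1 := by
    intro t
    rw [add_comm, hP (n + t), Finset.sum_range_add, ← hP n, hn, hP t]
    simp
    ring
  have hsurj : ∀ y : ZMod n, ∃ s < n, y = -(s : ZMod n) := fun y =>
    ⟨(-y).val, ZMod.val_lt _, by simp⟩
  obtain ⟨s0, hs0, hmin0⟩ := Finset.exists_min_image (range n) P ⟨0, by simp; omega⟩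
  have hex : ∃ s, s < n ∧ ∀ t < n, P s ≤ P t :=
    ⟨s0, by simpa using hs0, fun t ht => hmin0 t (by simpa using ht)⟩
  classical
  have hs := Nat.find_spec hex
  have hlt := fun t => Nat.find_min (m := t) hex
  set s := Nat.find hex
  have hgood : ∀ k < n, P s ≤ P (s + k) := by
    intro k hk
    by_cases h : s + k < n
    · exact hs.2 _ h
    · obtain ⟨t, ht⟩ : ∃ t, s + k = t + n := ⟨s + k - n, by omega⟩
      rw [ht, hper]
      have h1 := hs.2 t (by omega)
      have h2 : P t ≠ P s := fun h2 =>
        hlt t (by omega) ⟨by omega, fun u hu => h2 ▸ hs.2 u hu⟩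
      omega
  have huniq : ∀ a b, a < b → b < n → (∀ k < n, P a ≤ P (a + k)) →
      (∀ k < n, P b ≤ P (b + k)) → False := by
    intro a b hab hb h1 h2
    have h3 := h1 (b - a) (by omega)
    have h4 := h2 (a + n - b) (by omega)
    rw [show a + (b - a) = b by omega] at h3
    rw [show b + (a + n - b) = a + n by omega, hper] at h4
    omega
  refine ⟨-(s : ZMod n), (hiff s).2 hgood, ?_⟩
  intro y hy
  obtain ⟨t, ht, rfl⟩ := hsurj y
  have ht' := (hiff t).1 hy
  rcases lt_trichotomy t s with h | h | h
  · exact (huniq t s h hs.1 ht' hgood).elim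
  · rw [h]
  · exact (huniq s t h ht hgood ht').elim

/-- Among the translates `(y + x_1, …, y + x_{n-1})` of a sequence, `y ∈ ℤ/nℤ`, exactly one is a
parking function. -/
theorem existsUnique_shift {n : ℕ} [NeZero n] (x : Fin n → ZMod n) :
    ∃! y : ZMod n, IsParkingFunction (initialResidues fun i => y + x i) :=
  existsUnique_shift_aux (Nat.sub_add_cancel (NeZero.one_le (n := n)))
    (fun i => x (Fin.castLE (Nat.sub_le n 1) i))

/-- The unique `y ∈ ℤ/nℤ` such that `(y + x_1, …, y + x_{n-1})` is a parking function. -/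
noncomputable def parkingShift {n : ℕ} [NeZero n] (x : Fin n → ZMod n) : ZMod n :=
  (existsUnique_shift x).choose

theorem parkingShift_spec {n : ℕ} [NeZero n] (x : Fin n → ZMod n) :
    IsParkingFunction (initialResidues fun i => parkingShift x + x i) :=
  (existsUnique_shift x).choose_spec.1

theorem eq_parkingShift {n : ℕ} [NeZero n] (x : Fin n → ZMod n) (y : ZMod n)
    (h : IsParkingFunction (initialResidues fun i => y + x i)) : y = parkingShift x :=
  (existsUnique_shift x).choose_spec.2 y h

namespace ExtParkingFunction

/-- The action of a permutation `π`: the sequence `(x_1, …, x_n)` goes to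
`(y + x_{π_1}, …, y + x_{π_n})`, for the unique `y ∈ ℤ/nℤ` for which the first `n - 1` entries form
a parking function. -/
noncomputable def act {n c : ℕ} [NeZero n] (π : Equiv.Perm (Fin n))
    (x : ExtParkingFunction n c) : ExtParkingFunction n c :=
  ⟨fun i => parkingShift (fun j => x.1 (π j)) + x.1 (π i), parkingShift_spec _, by
    rw [Finset.sum_add_distrib, Equiv.sum_comp π x.1, x.2.2]
    simp⟩

/-- The action `τ_{n,c}` of the symmetric group. Since `π` permutes positions by
`(x_1, …, x_n) ↦ (x_{π_1}, …, x_{π_n})`, products of permutations are read from left to right, that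
is, the acting group is the opposite of `Equiv.Perm (Fin n)`. -/
noncomputable instance {n c : ℕ} [NeZero n] :
    MulAction (Equiv.Perm (Fin n))ᵐᵒᵖ (ExtParkingFunction n c) where
  smul π x := act π.unop x
  one_smul x := by
    apply Subtype.ext
    funext i
    change parkingShift (fun j => x.1 j) + x.1 i = x.1 i
    rw [← eq_parkingShift (fun j => x.1 j) 0 (by simpa using x.2.1), zero_add]
  mul_smul π σ x := by
    apply Subtype.ext
    funext i
    change parkingShift (fun j => x.1 (σ.unop (π.unop j))) + x.1 (σ.unop (π.unop i)) =
      parkingShift (fun j => parkingShift (fun l => x.1 (σ.unop l)) + x.1 (σ.unop (π.unop j))) +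
        (parkingShift (fun l => x.1 (σ.unop l)) + x.1 (σ.unop (π.unop i)))
    rw [← add_assoc]
    congr 1
    symm
    apply eq_parkingShift
    simpa only [add_assoc] using
      parkingShift_spec (fun j => parkingShift (fun l => x.1 (σ.unop l)) + x.1 (σ.unop (π.unop j)))

/-- The character of the action `τ_{n,c}`: the trace, at a permutation `π`, of the associated
permutation representation on the complex vector space with basis `ExtParkingFunction n c`. -/
noncomputable def character (n c : ℕ) [NeZero n] (π : Equiv.Perm (Fin n)) : ℂ :=
  (Representation.ofMulAction ℂ (Equiv.Perm (Fin n))ᵐᵒᵖ (ExtParkingFunction n c)).character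
    (MulOpposite.op π)

/-- The number of orbits of the action `τ_{n,c}`. -/
noncomputable def orbitCount (n c : ℕ) [NeZero n] : ℕ :=
  Nat.card (MulAction.orbitRel.Quotient (Equiv.Perm (Fin n))ᵐᵒᵖ (ExtParkingFunction n c))

end ExtParkingFunction

/-!
Translating a sequence by a constant of `ℤ/nℤ` does not change its sum, and every translation class
contains exactly one extended parking function. So `n` times the number of fixed points of `π` is
the number of pairs `(x, y)` with `x ∘ π = x - y` and `∑ x = 1` (`card_fixedBy_mul`). For a given
`y`, such an `x` is determined by its values `u_q` at representatives of the cycles of `π`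
(`Equiv.Perm.Cycles.semiconjEquiv`). With `l_q` the cycle lengths and `g` their greatest common
divisor, the conditions are `g y = 0` and the linear congruence
`∑ l_q u_q = 1 + ∑ (l_q choose 2) y`. It has `g n ^ (ℓ - 1)` solutions if the right-hand side is a
multiple of `g`, and none otherwise (`card_sum_nsmul_eq`). Doubling the right-hand side kills the
term in `y`, so `g ∣ 2`; for `g = 2` the only possible shift is `y = n / 2`, and it works exactly
when `n ≡ 2` modulo `4` (`gcd_eq_one_or_two`, `exists_half_shift`). This gives the character.

The number of orbits follows by Burnside's lemma. Möbius inversion over the divisors of the greatest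
common divisor reduces the sum of the character to the sums of `n ^ ℓ(π)` over the permutations `π`
whose cycle lengths are all divisible by a given `d ∣ n`. Here `n ^ ℓ(π)` is the number of functions
`f` from `n` points to `B × ℤ/dℤ`, where `B` has `n / d` elements, such that `f ∘ π = σ ∘ f` for the
translation `σ` of the second coordinate; there are no such `f` for the other permutations
(`Equiv.Perm.card_semiconj_prod`). Summed over all permutations, the number of these `f` is `n!`
times the number of `σ`-invariant multisets of size `n` (`sum_card_semiconj`), and those are the
products of a multiset of size `n / d` on `B` with `ℤ/dℤ` (`card_sym_invariant`). Hence the sum is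
`n! * (2 n / d - 1 choose n / d)` (`sum_pow_card_parts`). The sign in the final formula absorbs the
contribution of the permutations with `g = 2` (`neg_one_pow_mul_moebius`).
-/

/-! ### The cycles of a permutation -/

namespace Equiv.Perm

variable {α : Type*}

/-- The cycles of a permutation, fixed points included: the classes of `SameCycle`. -/
abbrev Cycles (π : Equiv.Perm α) : Type _ := Quotient (SameCycle.setoid π)

namespace Cycles

variable {π : Equiv.Perm α}

/-- The length of a cycle, computed at its chosen representative. -/
noncomputable def length (q : Cycles π) : ℕ := Function.minimalPeriod π q.out

theorem iterate_length (q : Cycles π) : π^[q.length] q.out = q.out :=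
  Function.iterate_minimalPeriod

theorem apply_iterate {A : Type*} (σ : A → A) {f : α → A} (hf : ∀ i, f (π i) = σ (f i))
    (k : ℕ) (i : α) :
    f (π^[k] i) = σ^[k] (f i) :=
  (Function.Semiconj.iterate_right hf k) i

variable [Finite α]

theorem length_pos (q : Cycles π) : 0 < q.length := by
  apply Function.minimalPeriod_pos_of_mem_periodicPts
  obtain ⟨k, hk, h⟩ := (isOfFinOrder_of_finite π).exists_pow_eq_one
  refine ⟨k, hk, ?_⟩
  rw [Function.IsPeriodicPt, Function.IsFixedPt, ← Equiv.Perm.coe_pow, h, Equiv.Perm.one_apply]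

theorem bijective_iterate :
    Function.Bijective fun p : Σ q : Cycles π, Fin q.length => π^[p.2] p.1.out := by
  have hmk : ∀ (q : Cycles π) (k : ℕ), (Quotient.mk (SameCycle.setoid π) (π^[k] q.out)) = q := by
    intro q k
    conv_rhs => rw [← Quotient.out_eq q]
    refine Quotient.sound (SameCycle.symm ⟨k, ?_⟩)
    rw [zpow_natCast, Equiv.Perm.coe_pow]
  constructor
  · rintro ⟨q, k⟩ ⟨q', k'⟩ h
    dsimp only at h
    obtain rfl : q = q' := by rw [← hmk q k, h, hmk]
    congr 1
    exact Fin.ext (Function.iterate_injOn_Iio_minimalPeriod k.2 k'.2 h)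
  · intro i
    have h : SameCycle π (Quotient.mk (SameCycle.setoid π) i).out i :=
      Quotient.mk_out (s := SameCycle.setoid π) i
    obtain ⟨k, hk⟩ := h.exists_nat_pow_eq
    let q : Cycles π := Quotient.mk _ i
    refine ⟨⟨q, k % length q, Nat.mod_lt _ (length_pos q)⟩, ?_⟩
    dsimp only
    rw [length, Function.iterate_mod_minimalPeriod_eq, ← Equiv.Perm.coe_pow, hk]

/-- Every point is a unique iterate, below the length of its cycle, of the representative of its
cycle. -/
noncomputable def sigmaEquiv (π : Equiv.Perm α) : (Σ q : Cycles π, Fin q.length) ≃ α :=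
  Equiv.ofBijective _ bijective_iterate

theorem sigmaEquiv_apply (q : Cycles π) (k : Fin q.length) :
    sigmaEquiv π ⟨q, k⟩ = π^[k] q.out := rfl

section Semiconj
variable {A : Type*} (σ : A → A)

/-- A function `f` with `f ∘ π = σ ∘ f` amounts to the choice, for each cycle of `π` of length `l`,
of a point fixed by `σ^[l]`, the value of `f` at the representative of the cycle. -/
noncomputable def semiconjEquiv (π : Equiv.Perm α) :
    {f : α → A // ∀ i, f (π i) = σ (f i)} ≃ ∀ q : Cycles π, {a : A // σ^[q.length] a = a} := by
  refine Equiv.ofBijective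
    (fun f q => ⟨f.1 q.out, by rw [← apply_iterate σ f.2, iterate_length]⟩) ⟨?_, ?_⟩
  · intro f g h
    apply Subtype.ext
    funext i
    obtain ⟨⟨q, k⟩, rfl⟩ := (sigmaEquiv π).surjective i
    have hq : f.1 q.out = g.1 q.out := congrArg Subtype.val (congrFun h q)
    rw [sigmaEquiv_apply, apply_iterate σ f.2, apply_iterate σ g.2, hq]
  · intro u
    let F : (Σ q : Cycles π, Fin q.length) → A := fun p => σ^[p.2] (u p.1).1
    have hF : ∀ (q : Cycles π) (k : Fin q.length),
        F ((sigmaEquiv π).symm (π^[k] q.out)) = σ^[k] (u q).1 := by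
      intro q k
      rw [← sigmaEquiv_apply, Equiv.symm_apply_apply]
    have h0 : ∀ q : Cycles π, F ((sigmaEquiv π).symm q.out) = (u q).1 :=
      fun q => hF q ⟨0, length_pos q⟩
    refine ⟨⟨fun i => F ((sigmaEquiv π).symm i), ?_⟩, ?_⟩
    · intro i
      obtain ⟨⟨q, k⟩, rfl⟩ := (sigmaEquiv π).surjective i
      dsimp only
      rw [sigmaEquiv_apply, hF, ← Function.iterate_succ_apply' π, ← Function.iterate_succ_apply' σ]
      -- At the end of a cycle, `σ^[l] u = u` makes the values close up.
      rcases Nat.lt_or_ge (k + 1) q.length with h | h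
      · exact hF q ⟨k + 1, h⟩
      · have h' : (k : ℕ).succ = q.length := le_antisymm k.2 h
        rw [h', iterate_length, h0, (u q).2]
    · funext q
      exact Subtype.ext (h0 q)

end Semiconj
end Cycles

variable [Fintype α] (π : Equiv.Perm α)

noncomputable instance : Fintype (Cycles π) := Fintype.ofFinite _

theorem sum_eq_sum_cycles {M : Type*} [AddCommMonoid M] (g : α → M) :
    ∑ i, g i = ∑ q : Cycles π, ∑ k ∈ range q.length, g (π^[k] q.out) := by
  rw [← Equiv.sum_comp (Cycles.sigmaEquiv π), Fintype.sum_sigma]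
  refine Finset.sum_congr rfl fun q _ => ?_
  exact Fin.sum_univ_eq_sum_range (fun k => g (π^[k] q.out)) q.length

theorem sum_length : ∑ q : Cycles π, q.length = Fintype.card α := by
  have h := sum_eq_sum_cycles π fun _ => 1
  simpa using h.symm

variable [DecidableEq α]

theorem two_le_length_iff {q : Cycles π} : 2 ≤ q.length ↔ q.out ∈ π.support := by
  have h1 := q.length_pos
  have h2 : q.length = 1 ↔ π q.out = q.out := Function.minimalPeriod_eq_one_iff_isFixedPt
  rw [mem_support, ne_eq, ← h2]
  omega

theorem card_support_cycleOf_out {q : Cycles π} (hq : 2 ≤ q.length) :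
    #(π.cycleOf q.out).support = q.length := by
  have hmem : q.out ∈ (π.cycleOf q.out).support :=
    mem_support_cycleOf_iff.2 ⟨.refl _ _, (two_le_length_iff π).1 hq⟩
  have h := fun k => (isCycleOn_support_cycleOf π q.out).pow_apply_eq hmem (n := k)
  apply Nat.dvd_antisymm
  · rw [← h, coe_pow, q.iterate_length]
  · apply Function.IsPeriodicPt.minimalPeriod_dvd
    rw [Function.IsPeriodicPt, Function.IsFixedPt, ← coe_pow, h]

theorem cycleType_eq_map_length :
    π.cycleType = ((univ : Finset (Cycles π)).filter (2 ≤ ·.length)).val.map Cycles.length := by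
  rw [cycleType_def]
  symm
  refine Multiset.map_eq_map_of_bij_of_nodup _ _ (Finset.nodup _) (Finset.nodup _)
    (fun q _ => π.cycleOf q.out) ?_ ?_ ?_ ?_
  · intro q hq
    exact cycleOf_mem_cycleFactorsFinset_iff.2 ((two_le_length_iff π).1 (by simpa using hq))
  · intro q hq q' hq' h
    rw [← sameCycle_iff_cycleOf_eq_of_mem_support
      ((two_le_length_iff π).1 (by simpa using hq)) ((two_le_length_iff π).1 (by simpa using hq'))]
      at h
    rw [← Quotient.out_eq q, ← Quotient.out_eq q']
    exact Quotient.sound h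
  · intro c hc
    obtain ⟨a, ha⟩ := (mem_cycleFactorsFinset_iff.1 hc).1.nonempty_support
    have hsame : SameCycle π (Quotient.mk (SameCycle.setoid π) a).out a :=
      Quotient.mk_out (s := SameCycle.setoid π) a
    have ha' : a ∈ π.support := mem_cycleFactorsFinset_support_le hc ha
    refine ⟨Quotient.mk _ a, ?_, ?_⟩
    · simp only [Finset.mem_val, Finset.mem_filter, Finset.mem_univ, true_and]
      exact (two_le_length_iff π).2 (hsame.mem_support_iff.2 ha')
    · rw [hsame.cycleOf_eq, cycle_is_cycleOf ha hc]
  · intro q hq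
    exact (card_support_cycleOf_out π (by simpa using hq)).symm

/-- The parts of the cycle type, fixed points included, are the lengths of the cycles. -/
theorem partition_parts_eq_map_length :
    π.partition.parts = (univ : Finset (Cycles π)).val.map Cycles.length := by
  have hrest : ((univ : Finset (Cycles π)).filter (¬ 2 ≤ ·.length)).val.map Cycles.length =
      Multiset.replicate #((univ : Finset (Cycles π)).filter (¬ 2 ≤ ·.length)) 1 := by
    rw [Multiset.eq_replicate]
    refine ⟨by rw [Multiset.card_map]; rfl, fun b hb => ?_⟩
    obtain ⟨q, hq, rfl⟩ := Multiset.mem_map.1 hb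
    have h1 := q.length_pos
    have h2 : ¬ 2 ≤ q.length := by simpa using hq
    omega
  have hsplit : (univ : Finset (Cycles π)).val.map Cycles.length = π.cycleType +
      Multiset.replicate #((univ : Finset (Cycles π)).filter (¬ 2 ≤ ·.length)) 1 := by
    rw [← hrest, cycleType_eq_map_length, ← Multiset.map_add, Finset.filter_val, Finset.filter_val,
      Multiset.filter_add_not]
  have hsum := congrArg Multiset.sum hsplit
  -- The number of cycles of length one is found by comparing the sums of the two multisets.
  have hcard : ((univ : Finset (Cycles π)).val.map Cycles.length).sum = Fintype.card α :=
    sum_length π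
  rw [hcard, Multiset.sum_add, sum_cycleType, Multiset.sum_replicate, smul_eq_mul, mul_one] at hsum
  rw [parts_partition, hsplit, hsum, Nat.add_sub_cancel_left]

theorem card_partition_parts : Multiset.card π.partition.parts = Fintype.card (Cycles π) := by
  rw [partition_parts_eq_map_length, Multiset.card_map]
  rfl

theorem dvd_gcd_partition_parts_iff {d : ℕ} :
    d ∣ π.partition.parts.gcd ↔ ∀ q : Cycles π, d ∣ q.length := by
  rw [Multiset.dvd_gcd, partition_parts_eq_map_length]
  simp

end Equiv.Perm

/-! ### Linear congruences with several unknowns -/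

theorem gcd_dvd_sum_nsmul {n : ℕ} {ι : Type*} [Fintype ι] (l : ι → ℕ) (u : ι → ZMod n) :
    ∃ b : ZMod n, ∑ q, l q • u q = (univ.gcd l : ℕ) * b := by
  choose k hk using fun q => Finset.gcd_dvd (f := l) (mem_univ q)
  refine ⟨∑ q, k q * u q, ?_⟩
  rw [Finset.mul_sum]
  refine Finset.sum_congr rfl fun q _ => ?_
  nth_rw 1 [hk q]
  rw [nsmul_eq_mul, Nat.cast_mul, mul_assoc]

theorem exists_sum_nsmul_eq {n : ℕ} {ι : Type*} [Fintype ι] (l : ι → ℕ) (b : ZMod n) :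
    ∃ u : ι → ZMod n, ∑ q, l q • u q = (univ.gcd l : ℕ) * b := by
  obtain ⟨a, ha⟩ := Finset.gcd_eq_sum_mul univ (fun q => (l q : ℤ))
  have h : (univ.gcd fun q => (l q : ℤ)) ∣ ((univ.gcd l : ℕ) : ℤ) := by
    rw [← Int.natAbs_dvd, Int.natCast_dvd_natCast]
    refine Finset.dvd_gcd fun q hq => ?_
    rw [← Int.natCast_dvd_natCast, Int.natAbs_dvd]
    exact Finset.gcd_dvd hq
  obtain ⟨k, hk⟩ := h
  refine ⟨fun q => (a q * k : ℤ) * b, ?_⟩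
  have hk' := congrArg (Int.cast (R := ZMod n)) hk
  rw [ha] at hk'
  push_cast at hk'
  rw [hk', Finset.sum_mul, Finset.sum_mul]
  refine Finset.sum_congr rfl fun q _ => ?_
  rw [nsmul_eq_mul]
  push_cast
  ring

/-- The linear congruence `∑ l_q u_q = c` modulo `n` has `g n ^ (r - 1)` solutions in `r` unknowns,
where `g` is the greatest common divisor of the coefficients and divides `n`, provided that `c` is
a multiple of `g`. -/
theorem card_sum_nsmul_eq {n : ℕ} [NeZero n] {ι : Type*} [Fintype ι] (l : ι → ℕ)
    (hg : univ.gcd l ∣ n) (b : ZMod n) :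
    n * Nat.card {u : ι → ZMod n // ∑ q, l q • u q = (univ.gcd l : ℕ) * b} =
      univ.gcd l * n ^ Fintype.card ι := by
  let φ : (ι → ZMod n) →+ ZMod n :=
    ∑ q, (l q) • Pi.evalAddMonoidHom (fun _ : ι => ZMod n) q
  have hφ : ∀ u, φ u = ∑ q, l q • u q := fun u => by simp [φ]
  obtain ⟨u₀, hu₀⟩ := exists_sum_nsmul_eq l b
  have hker : Nat.card {u : ι → ZMod n // ∑ q, l q • u q = (univ.gcd l : ℕ) * b} =
      Nat.card φ.ker := by
    refine Nat.card_congr ((Equiv.subRight u₀).subtypeEquiv fun u => ?_)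
    rw [AddMonoidHom.mem_ker, Equiv.subRight_apply, map_sub, hφ, hφ, hu₀, sub_eq_zero]
  have hrange : φ.range = AddSubgroup.zmultiples ((univ.gcd l : ℕ) : ZMod n) := by
    ext c
    rw [AddMonoidHom.mem_range, AddSubgroup.mem_zmultiples_iff]
    constructor
    · rintro ⟨u, rfl⟩
      obtain ⟨b, hb⟩ := gcd_dvd_sum_nsmul l u
      exact ⟨b.val, by rw [hφ, hb]; simp [mul_comm]⟩
    · rintro ⟨k, rfl⟩
      obtain ⟨u, hu⟩ := exists_sum_nsmul_eq l (k : ZMod n)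
      exact ⟨u, by rw [hφ, hu]; simp [mul_comm]⟩
  have hcard := φ.ker.card_mul_index
  rw [AddSubgroup.index_ker, hrange, Nat.card_zmultiples, ZMod.addOrderOf_coe _ (NeZero.ne n),
    Nat.gcd_eq_right hg, Nat.card_fun, Nat.card_zmod] at hcard
  rw [hker, ← Nat.card_eq_fintype_card, ← hcard]
  calc n * Nat.card φ.ker = univ.gcd l * (n / univ.gcd l) * Nat.card φ.ker := by
        rw [Nat.mul_div_cancel' hg]
    _ = _ := by ring

/-! ### Functions semiconjugate to a translation -/

namespace Equiv.Perm

theorem gcd_partition_parts {α : Type*} [Fintype α] [DecidableEq α] (π : Equiv.Perm α) :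
    π.partition.parts.gcd = (univ : Finset (Cycles π)).gcd Cycles.length := by
  rw [partition_parts_eq_map_length]
  rfl

theorem card_semiconj_prod {α : Type*} [Fintype α] [DecidableEq α] (π : Equiv.Perm α)
    {A : Type*} [Finite A] {d : ℕ} [NeZero d] :
    Nat.card {f : α → A × ZMod d // ∀ i, f (π i) = ((f i).1, (f i).2 + 1)} =
      if d ∣ π.partition.parts.gcd then
        (Nat.card A * d) ^ Multiset.card π.partition.parts else 0 := by
  have hit : ∀ (k : ℕ) (a : A × ZMod d), (fun a : A × ZMod d => (a.1, a.2 + 1))^[k] a =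
      (a.1, a.2 + k) := by
    intro k a
    induction k with
    | zero => simp
    | succ k ih => rw [Function.iterate_succ_apply', ih]; simp [add_assoc]
  rw [Nat.card_congr (Cycles.semiconjEquiv (fun a : A × ZMod d => (a.1, a.2 + 1)) π), Nat.card_pi,
    card_partition_parts]
  have hfix : ∀ (k : ℕ) (a : A × ZMod d), (fun a : A × ZMod d => (a.1, a.2 + 1))^[k] a = a ↔
      d ∣ k := by
    intro k a
    rw [hit, Prod.ext_iff, ← ZMod.natCast_eq_zero_iff]
    simp
  simp only [hfix]
  split_ifs with h
  · rw [dvd_gcd_partition_parts_iff] at h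
    rw [Finset.prod_congr rfl fun q _ => by
      rw [Nat.card_congr (Equiv.subtypeUnivEquiv fun _ => h q), Nat.card_prod, Nat.card_zmod]]
    simp
  · rw [dvd_gcd_partition_parts_iff] at h
    push Not at h
    obtain ⟨q, hq⟩ := h
    refine Finset.prod_eq_zero (mem_univ q) ?_
    have : IsEmpty {_a : A × ZMod d // d ∣ q.length} := ⟨fun a => hq a.2⟩
    exact Nat.card_of_isEmpty

theorem gcd_partition_parts_dvd {n : ℕ} (π : Equiv.Perm (Fin n)) : π.partition.parts.gcd ∣ n := by
  have h := sum_length π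
  rw [Fintype.card_fin] at h
  have hdvd : π.partition.parts.gcd ∣ ∑ q : Cycles π, q.length :=
    Finset.dvd_sum fun q _ => (dvd_gcd_partition_parts_iff π).1 dvd_rfl q
  rwa [h] at hdvd

section Translation

variable {n : ℕ} (π : Equiv.Perm (Fin n)) (y c : ZMod n)

theorem iterate_sub_const (k : ℕ) (a : ZMod n) : (fun a => a - y)^[k] a = a - k • y := by
  induction k with
  | zero => simp
  | succ k ih => rw [Function.iterate_succ_apply', ih, succ_nsmul]; ring

theorem length_nsmul_eq_zero {x : Fin n → ZMod n} (hx : ∀ i, x (π i) = x i - y) (q : Cycles π) :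
    q.length • y = 0 := by
  have h := Cycles.apply_iterate (fun a => a - y) hx q.length q.out
  rw [q.iterate_length, iterate_sub_const] at h
  exact sub_eq_self.1 h.symm

theorem gcd_nsmul_eq_zero_iff :
    π.partition.parts.gcd • y = 0 ↔ ∀ q : Cycles π, q.length • y = 0 := by
  simp only [← addOrderOf_dvd_iff_nsmul_eq_zero]
  exact dvd_gcd_partition_parts_iff π

/-- Along a cycle of length `l` starting at `u`, the values of `x` are `u, u - y, u - 2 y, …`, whose
sum is `l u - (l choose 2) y`. -/
theorem sum_add_nsmul_eq {x : Fin n → ZMod n} (hx : ∀ i, x (π i) = x i - y) :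
    ∑ i, x i + (∑ q : Cycles π, q.length.choose 2) • y =
      ∑ q : Cycles π, q.length • x q.out := by
  rw [sum_eq_sum_cycles π x, ← Finset.sum_nsmul_assoc, ← Finset.sum_add_distrib]
  refine Finset.sum_congr rfl fun q _ => ?_
  rw [Finset.sum_congr rfl fun k _ => by
    rw [Cycles.apply_iterate (fun a => a - y) hx, iterate_sub_const], Finset.sum_sub_distrib,
    Finset.sum_nsmul_assoc, Finset.sum_range_id, ← Nat.choose_two_right]
  simp

/-- If `g y = 0` for the greatest common divisor `g` of the cycle lengths of `π`, then the sequences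
`x` with `x ∘ π = x - y` and a prescribed sum are the solutions of a linear congruence. -/
theorem card_translation_eq (hy : π.partition.parts.gcd • y = 0) :
    Nat.card {x : Fin n → ZMod n // (∀ i, x (π i) = x i - y) ∧ ∑ i, x i = c} =
      Nat.card {u : Cycles π → ZMod n // ∑ q, q.length • u q =
        c + (∑ q : Cycles π, q.length.choose 2) • y} := by
  have hall : ∀ (q : Cycles π) (a : ZMod n), (fun a => a - y)^[q.length] a = a := by
    intro q a
    rw [iterate_sub_const, (gcd_nsmul_eq_zero_iff π y).1 hy q, sub_zero]
  let e : {x : Fin n → ZMod n // ∀ i, x (π i) = x i - y} ≃ (Cycles π → ZMod n) :=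
    (Cycles.semiconjEquiv (fun a => a - y) π).trans
      (Equiv.piCongrRight fun q => Equiv.subtypeUnivEquiv (hall q))
  have he : ∀ x q, e x q = x.1 q.out := fun _ _ => rfl
  rw [← Nat.card_congr (Equiv.subtypeSubtypeEquivSubtypeInter _ _)]
  refine Nat.card_congr (e.subtypeEquiv fun x => ?_)
  simp only [he]
  rw [← sum_add_nsmul_eq π y x.2, add_left_inj]

end Translation

end Equiv.Perm

/-! ### Fixed points of the action on extended parking functions -/

namespace ExtParkingFunction

open Equiv.Perm

variable {n : ℕ} [NeZero n]

instance {c : ℕ} : Finite (ExtParkingFunction n c) :=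
  inferInstanceAs (Finite {_x : Fin n → ZMod n // _})

theorem character_eq_card_fixedBy (c : ℕ) (π : Equiv.Perm (Fin n)) :
    character n c π =
      Nat.card (MulAction.fixedBy (ExtParkingFunction n c) (MulOpposite.op π)) := by
  classical
  have : Fintype (ExtParkingFunction n c) := Fintype.ofFinite _
  rw [character, Representation.character,
    LinearMap.trace_eq_matrix_trace ℂ (MonoidAlgebra.basis (ExtParkingFunction n c) ℂ),
    Matrix.trace, Nat.card_eq_fintype_card, Fintype.card_subtype]
  rw [Finset.card_filter, Nat.cast_sum]
  refine Finset.sum_congr rfl fun x _ => ?_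
  rw [Matrix.diag_apply, LinearMap.toMatrix_apply, MonoidAlgebra.basis_apply,
    Representation.ofMulAction_single]
  change (MonoidAlgebra.single _ (1 : ℂ)).coeff x = _
  rw [MonoidAlgebra.coeff_single, Finsupp.single_apply]
  simp only [MulAction.mem_fixedBy, Nat.cast_ite, Nat.cast_one, Nat.cast_zero]

theorem mem_fixedBy_iff {c : ℕ} {π : Equiv.Perm (Fin n)} {z : ExtParkingFunction n c} :
    z ∈ MulAction.fixedBy (ExtParkingFunction n c) (MulOpposite.op π) ↔
      ∃ y, ∀ i, z.1 (π i) = z.1 i - y := by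
  have hsmul : (MulOpposite.op π • z = z) ↔
      ∀ i, parkingShift (fun j => z.1 (π j)) + z.1 (π i) = z.1 i := by
    exact Subtype.ext_iff.trans funext_iff
  rw [MulAction.mem_fixedBy, hsmul]
  constructor
  · intro h
    exact ⟨parkingShift fun j => z.1 (π j), fun i => by rw [← h i]; ring⟩
  · rintro ⟨y, hy⟩ i
    have hz : (fun j => y + z.1 (π j)) = z.1 := by
      funext j
      rw [hy]
      ring
    rw [← eq_parkingShift (fun j => z.1 (π j)) y (by rw [hz]; exact z.2.1)]
    exact congrFun hz i

/-- Every translation class of sequences with sum `c` contains exactly one extended parking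
function, and `π` fixes the latter if and only if it maps the class to itself. -/
noncomputable def fixedByProdEquiv (c : ℕ) (π : Equiv.Perm (Fin n)) :
    MulAction.fixedBy (ExtParkingFunction n c) (MulOpposite.op π) × ZMod n ≃
      Σ y : ZMod n, {x : Fin n → ZMod n // (∀ i, x (π i) = x i - y) ∧ ∑ i, x i = c} := by
  let T := {x : Fin n → ZMod n // (∃ y, ∀ i, x (π i) = x i - y) ∧ ∑ i, x i = c}
  have hsum : ∀ (x : Fin n → ZMod n) (t : ZMod n), ∑ i, (t + x i) = ∑ i, x i := by
    intro x t
    simp [Finset.sum_add_distrib]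
  let e₁ : MulAction.fixedBy (ExtParkingFunction n c) (MulOpposite.op π) × ZMod n ≃ T :=
    { toFun := fun p => ⟨fun i => p.2 + p.1.1.1 i, by
        obtain ⟨y, hy⟩ := mem_fixedBy_iff.1 p.1.2
        exact ⟨y, fun i => by dsimp only; rw [hy]; ring⟩, by rw [hsum, p.1.1.2.2]⟩
      invFun := fun x => (⟨⟨fun i => parkingShift x.1 + x.1 i, parkingShift_spec _,
        by rw [hsum, x.2.2]⟩, mem_fixedBy_iff.2 <| by
          obtain ⟨y, hy⟩ := x.2.1
          exact ⟨y, fun i => by dsimp only; rw [hy]; ring⟩⟩, -parkingShift x.1)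
      left_inv := fun p => by
        have h : -p.2 = parkingShift fun i => p.2 + p.1.1.1 i :=
          eq_parkingShift _ _ (by simpa using p.1.1.2.1)
        refine Prod.ext (Subtype.ext (Subtype.ext (funext fun i => ?_))) ?_
        · change parkingShift (fun i => p.2 + p.1.1.1 i) + (p.2 + p.1.1.1 i) = p.1.1.1 i
          rw [← h]
          ring
        · change -parkingShift (fun i => p.2 + p.1.1.1 i) = p.2
          rw [← h, neg_neg]
      right_inv := fun x => by
        apply Subtype.ext
        funext i
        exact neg_add_cancel_left _ _ }
  let e₂ : (Σ y : ZMod n, {x : Fin n → ZMod n // (∀ i, x (π i) = x i - y) ∧ ∑ i, x i = c}) ≃ T :=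
    Equiv.ofBijective (fun p => ⟨p.2.1, ⟨p.1, p.2.2.1⟩, p.2.2.2⟩) <| by
      constructor
      · rintro ⟨y, x, hx⟩ ⟨y', x', hx'⟩ h
        obtain rfl : x = x' := congrArg Subtype.val h
        obtain rfl : y = y' := by
          have h1 := hx.1 0
          rw [hx'.1 0] at h1
          exact (sub_right_injective h1).symm
        rfl
      · rintro ⟨x, ⟨y, hy⟩, hx⟩
        exact ⟨⟨y, x, hy, hx⟩, rfl⟩
  exact e₁.trans e₂.symm

theorem card_fixedBy_mul (c : ℕ) (π : Equiv.Perm (Fin n)) :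
    n * Nat.card (MulAction.fixedBy (ExtParkingFunction n c) (MulOpposite.op π)) =
      ∑ y : ZMod n, Nat.card
        {x : Fin n → ZMod n // (∀ i, x (π i) = x i - y) ∧ ∑ i, x i = c} := by
  have h := Nat.card_congr (fixedByProdEquiv c π)
  rwa [Nat.card_prod, Nat.card_zmod, Nat.card_sigma, mul_comm] at h

theorem mul_card_translation (π : Equiv.Perm (Fin n)) {y c b : ZMod n}
    (hy : π.partition.parts.gcd • y = 0)
    (hb : c + (∑ q : Cycles π, q.length.choose 2) • y = π.partition.parts.gcd * b) :
    n * Nat.card {x : Fin n → ZMod n // (∀ i, x (π i) = x i - y) ∧ ∑ i, x i = c} =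
      π.partition.parts.gcd * n ^ Multiset.card π.partition.parts := by
  rw [card_translation_eq π y c hy, hb, card_partition_parts, gcd_partition_parts]
  refine card_sum_nsmul_eq _ ?_ b
  rw [← gcd_partition_parts]
  exact gcd_partition_parts_dvd π

theorem exists_eq_gcd_mul {n : ℕ} {π : Equiv.Perm (Fin n)} {y c : ZMod n}
    (h : Nat.card {x : Fin n → ZMod n // (∀ i, x (π i) = x i - y) ∧ ∑ i, x i = c} ≠ 0) :
    π.partition.parts.gcd • y = 0 ∧
      ∃ b, c + (∑ q : Cycles π, q.length.choose 2) • y = π.partition.parts.gcd * b := by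
  obtain ⟨⟨x, hx, hsum⟩⟩ := (Nat.card_ne_zero.1 h).1
  refine ⟨(gcd_nsmul_eq_zero_iff π y).2 (length_nsmul_eq_zero π y hx), ?_⟩
  rw [← hsum, sum_add_nsmul_eq π y hx, gcd_partition_parts]
  exact gcd_dvd_sum_nsmul _ _

/-- Doubling `1 + ∑ (l choose 2) y ≡ 0` modulo the greatest common divisor `g` of the cycle lengths
`l` leaves `2 ≡ 0`, because `l y = 0`; for `g = 2` the shift `y` has to be `n / 2`, and odd. -/
theorem gcd_eq_one_or_two {π : Equiv.Perm (Fin n)} {y b : ZMod n}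
    (hy : π.partition.parts.gcd • y = 0)
    (hb : 1 + (∑ q : Cycles π, q.length.choose 2) • y = π.partition.parts.gcd * b) :
    π.partition.parts.gcd = 1 ∨
      π.partition.parts.gcd = 2 ∧ n ≡ 2 [MOD 4] ∧ y = (n / 2 : ℕ) := by
  have hgn := gcd_partition_parts_dvd π
  have hl := (gcd_nsmul_eq_zero_iff π y).1 hy
  set g := π.partition.parts.gcd with hg
  have htwo : (2 : ZMod n) = g * (2 * b) := by
    have hC : 2 * ((∑ q : Cycles π, q.length.choose 2) • y) = 0 := by
      rw [← Finset.sum_nsmul_assoc, Finset.mul_sum]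
      refine Finset.sum_eq_zero fun q _ => ?_
      have h : q.length.choose 2 * 2 = q.length * (q.length - 1) := by
        rw [Nat.choose_two_right, Nat.div_mul_cancel (Nat.even_mul_pred_self _).two_dvd]
      calc 2 * (q.length.choose 2 • y) = (q.length.choose 2 * 2) • y := by
            rw [mul_comm (q.length.choose 2), mul_nsmul, smul_comm]; simp [mul_comm]
        _ = 0 := by rw [h, mul_nsmul, hl q, smul_zero]
    calc (2 : ZMod n) = 2 * (1 + (∑ q : Cycles π, q.length.choose 2) • y) -
          2 * ((∑ q : Cycles π, q.length.choose 2) • y) := by ring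
      _ = g * (2 * b) := by rw [hC, hb]; ring
  have hg2 : g ∣ 2 := by
    have h := congrArg (ZMod.castHom hgn (ZMod g)) htwo
    rw [map_mul, map_natCast, ZMod.natCast_self, zero_mul, map_ofNat] at h
    exact (ZMod.natCast_eq_zero_iff 2 g).1 (by exact_mod_cast h)
  rcases (Nat.dvd_prime Nat.prime_two).1 hg2 with h | h
  · exact Or.inl h
  · refine Or.inr ⟨h, ?_⟩
    rw [h] at hy hb hgn
    have hn0 := NeZero.pos n
    have hval : n ∣ 2 * y.val := by
      rw [← ZMod.natCast_eq_zero_iff]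
      rw [Nat.cast_mul, ZMod.natCast_zmod_val, ← nsmul_eq_mul, hy]
    have hlt := ZMod.val_lt y
    have hodd : ¬ 2 ∣ y.val := by
      intro hdvd
      have h1 := congrArg (ZMod.castHom hgn (ZMod 2)) hb
      have hy2 : ZMod.castHom hgn (ZMod 2) y = 0 := by
        rw [← ZMod.natCast_zmod_val y, map_natCast]
        exact (ZMod.natCast_eq_zero_iff _ _).2 hdvd
      rw [map_mul, map_natCast, ZMod.natCast_self, zero_mul, map_add, map_nsmul, hy2, smul_zero,
        map_one, add_zero] at h1
      exact one_ne_zero h1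
    obtain ⟨k, hk⟩ := hval
    have hk1 : k = 1 := by
      have h1 : k < 2 := by nlinarith
      have h2 : k ≠ 0 := by
        rintro rfl
        exact hodd (by omega)
      omega
    subst hk1
    have hy3 : y.val = n / 2 := by omega
    refine ⟨by rw [Nat.ModEq]; omega, ?_⟩
    rw [← hy3, ZMod.natCast_zmod_val]

theorem exists_half_shift {n : ℕ} {π : Equiv.Perm (Fin n)} (h2 : π.partition.parts.gcd = 2)
    (hn : n ≡ 2 [MOD 4]) :
    ∃ b : ZMod n,
      1 + (∑ q : Cycles π, q.length.choose 2) • ((n / 2 : ℕ) : ZMod n) = (2 : ℕ) * b := by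
  choose m hm using (dvd_gcd_partition_parts_iff π).1 (dvd_of_eq h2.symm)
  have hsum : n = 2 * ∑ q : Cycles π, m q := by
    have h := sum_length π
    rw [Fintype.card_fin] at h
    rw [Finset.mul_sum]
    refine h.symm.trans ?_
    exact Finset.sum_congr rfl fun q _ => hm q
  -- For even cycle lengths `2 m` one has `(2 m choose 2) + m = 2 m ^ 2`.
  have hC : ∑ q : Cycles π, q.length.choose 2 + ∑ q : Cycles π, m q =
      2 * ∑ q : Cycles π, m q ^ 2 := by
    rw [← Finset.sum_add_distrib, Finset.mul_sum]
    refine Finset.sum_congr rfl fun q _ => ?_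
    rw [Nat.choose_two_right, hm q, mul_assoc, Nat.mul_div_cancel_left _ two_pos]
    rcases Nat.eq_zero_or_pos (m q) with h | h
    · simp [h]
    · obtain ⟨k, hk⟩ : ∃ k, m q = k + 1 := ⟨m q - 1, by omega⟩
      rw [hk, show 2 * (k + 1) - 1 = 2 * k + 1 by omega]
      ring
  have hodd1 : Odd (n / 2) := by
    rw [Nat.ModEq] at hn
    rw [Nat.odd_iff]
    omega
  have hodd2 : Odd (∑ q : Cycles π, q.length.choose 2) := by
    rw [Nat.odd_iff] at hodd1 ⊢
    omega
  obtain ⟨k, hk⟩ : Even (1 + (∑ q : Cycles π, q.length.choose 2) * (n / 2)) :=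
    Odd.add_odd odd_one (hodd2.mul hodd1)
  refine ⟨k, ?_⟩
  rw [nsmul_eq_mul]
  exact_mod_cast congrArg (Nat.cast (R := ZMod n)) (hk.trans (two_mul k).symm)

theorem sq_mul_card_fixedBy (π : Equiv.Perm (Fin n)) :
    n ^ 2 * Nat.card (MulAction.fixedBy (ExtParkingFunction n 1) (MulOpposite.op π)) =
      if π.partition.parts.gcd = 1 then n ^ Multiset.card π.partition.parts
      else if π.partition.parts.gcd = 2 ∧ n ≡ 2 [MOD 4] then
        2 * n ^ Multiset.card π.partition.parts
      else 0 := by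
  rw [sq, mul_assoc, card_fixedBy_mul, Nat.cast_one]
  split_ifs with h1 h2
  · rw [Finset.sum_eq_single_of_mem (0 : ZMod n) (mem_univ _), mul_card_translation π (b := 1)]
    · rw [h1, one_mul]
    · simp
    · simp [h1]
    · intro y _ hy
      by_contra h
      exact hy (by simpa [h1] using (exists_eq_gcd_mul h).1)
  · obtain ⟨b, hb⟩ := exists_half_shift h2.1 h2.2
    rw [Finset.sum_eq_single_of_mem ((n / 2 : ℕ) : ZMod n) (mem_univ _),
      mul_card_translation π (b := b), h2.1]
    · rw [h2.1, nsmul_eq_mul, ← Nat.cast_mul, Nat.mul_div_cancel', ZMod.natCast_self]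
      exact h2.1 ▸ gcd_partition_parts_dvd π
    · rw [hb, h2.1]
    · intro y _ hy
      by_contra h
      obtain ⟨h3, b, hb⟩ := exists_eq_gcd_mul h
      rcases gcd_eq_one_or_two h3 hb with h4 | h4
      · exact h1 h4
      · exact hy h4.2.2
  · rw [Finset.sum_eq_zero, mul_zero]
    intro y _
    by_contra h
    obtain ⟨h3, b, hb⟩ := exists_eq_gcd_mul h
    rcases gcd_eq_one_or_two h3 hb with h4 | h4
    · exact h1 h4
    · exact h2 ⟨h4.1, h4.2.1⟩

theorem character_one_eq (π : Equiv.Perm (Fin n)) :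
    character n 1 π =
      if π.partition.parts.gcd = 1 then
        (n : ℂ) ^ ((Multiset.card π.partition.parts : ℤ) - 2)
      else if π.partition.parts.gcd = 2 ∧ n ≡ 2 [MOD 4] then
        2 * (n : ℂ) ^ ((Multiset.card π.partition.parts : ℤ) - 2)
      else 0 := by
  have hn : (n : ℂ) ≠ 0 := NeZero.ne _
  rw [character_eq_card_fixedBy]
  have hn2 : (n : ℂ) ^ 2 ≠ 0 := pow_ne_zero 2 hn
  have h := congrArg (Nat.cast (R := ℂ)) (sq_mul_card_fixedBy π)
  have hz : (n : ℂ) ^ ((Multiset.card π.partition.parts : ℤ) - 2) =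
      (n : ℂ) ^ Multiset.card π.partition.parts / (n : ℂ) ^ 2 := by
    rw [zpow_sub₀ hn, zpow_natCast]
    rfl
  rw [hz]
  rw [Nat.cast_mul, Nat.cast_pow] at h
  refine mul_left_cancel₀ hn2 (h.trans ?_)
  split_ifs
  · rw [mul_div_cancel₀ _ hn2, Nat.cast_pow]
  · rw [mul_left_comm, mul_div_cancel₀ _ hn2, Nat.cast_mul, Nat.cast_pow, Nat.cast_ofNat]
  · simp

end ExtParkingFunction

/-! ### Permutations and semiconjugate functions -/

section Counting

variable {n : ℕ} {A : Type*}

/-- The multiset of the values of a function on `Fin n`. -/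
def valueMultiset (f : Fin n → A) : Sym A n := ⟨univ.val.map f, by simp⟩

theorem valueMultiset_surjective : Function.Surjective (valueMultiset : (Fin n → A) → Sym A n) := by
  rintro ⟨s, hs⟩
  induction s using Quotient.inductionOn with
  | h l =>
    subst hs
    refine ⟨l.get, Subtype.ext ?_⟩
    change univ.val.map l.get = l
    rw [Fin.univ_val_map, List.ofFn_get]

theorem valueMultiset_comp_perm (f : Fin n → A) (π : Equiv.Perm (Fin n)) :
    valueMultiset (f ∘ π) = valueMultiset f := by
  apply Subtype.ext
  change univ.val.map (f ∘ π) = univ.val.map f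
  rw [← Multiset.map_map, Multiset.map_univ_val_equiv]

theorem map_valueMultiset (σ : A → A) (f : Fin n → A) :
    (valueMultiset f).map σ = valueMultiset (σ ∘ f) := by
  apply Subtype.ext
  change (univ.val.map f).map σ = univ.val.map (σ ∘ f)
  rw [Multiset.map_map]

theorem exists_comp_perm_of_valueMultiset_eq {f g : Fin n → A}
    (h : valueMultiset f = valueMultiset g) : ∃ π : Equiv.Perm (Fin n), f ∘ π = g := by
  classical
  have hcard : ∀ a, Nonempty ({i // g i = a} ≃ {i // f i = a}) := by
    intro a
    have h1 := congrArg (Multiset.count a) (congrArg Subtype.val h)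
    change Multiset.count a (univ.val.map f) = Multiset.count a (univ.val.map g) at h1
    rw [Multiset.count_map, Multiset.count_map, ← Finset.filter_val, ← Finset.filter_val] at h1
    refine Fintype.card_eq.1 ?_
    rw [Fintype.card_subtype, Fintype.card_subtype]
    simp only [eq_comm (a := a)] at h1
    exact h1.symm
  exact ⟨Equiv.ofFiberEquiv fun a => (hcard a).some, funext fun i => Equiv.ofFiberEquiv_map _ i⟩

/-- If `f₀` and `f` have the same values and `σ` preserves their multiset, then there are as many
`π` with `f ∘ π = σ ∘ f` as with `f₀ ∘ π = f`: both sets are cosets of stabilizers of functions in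
the same orbit. -/
theorem card_perm_semiconj {σ : A → A} {f₀ f : Fin n → A}
    (h₀ : (valueMultiset f₀).map σ = valueMultiset f₀) (h : valueMultiset f = valueMultiset f₀) :
    Nat.card {π : Equiv.Perm (Fin n) // ∀ i, f (π i) = σ (f i)} =
      Nat.card {π : Equiv.Perm (Fin n) // f₀ ∘ π = f} := by
  obtain ⟨α, rfl⟩ := exists_comp_perm_of_valueMultiset_eq h.symm
  obtain ⟨β, hβ⟩ := exists_comp_perm_of_valueMultiset_eq (h₀.symm.trans (map_valueMultiset σ f₀))
  -- With `f = f₀ ∘ α` and `σ ∘ f₀ = f₀ ∘ β`, the bijection is `π ↦ α π α⁻¹ β⁻¹ α`.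
  refine Nat.card_congr (((Equiv.mulLeft α).trans
    (Equiv.mulRight (α⁻¹ * β⁻¹ * α))).subtypeEquiv fun π => ?_)
  have hβ' : ∀ i, σ (f₀ i) = f₀ (β i) := fun i => (congrFun hβ i).symm
  rw [funext_iff]
  simp only [Function.comp_apply, hβ', Equiv.trans_apply, Equiv.coe_mulLeft, Equiv.coe_mulRight,
    Equiv.Perm.mul_apply]
  constructor
  · intro hπ i
    rw [hπ]
    simp
  · intro hπ i
    have h1 := hπ (α⁻¹ (β (α i)))
    simpa using h1

/-- Counting the pairs `(π, f)` with `f ∘ π = σ ∘ f`: every multiset of values that `σ` preserves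
contributes `n!`. -/
theorem sum_card_semiconj [Finite A] (σ : A → A) :
    ∑ π : Equiv.Perm (Fin n), Nat.card {f : Fin n → A // ∀ i, f (π i) = σ (f i)} =
      n.factorial * Nat.card {s : Sym A n // s.map σ = s} := by
  classical
  have := Fintype.ofFinite A
  let P : Equiv.Perm (Fin n) → (Fin n → A) → Prop := fun π f => ∀ i, f (π i) = σ (f i)
  have hswap : ∑ π, Nat.card {f // P π f} = ∑ f, Nat.card {π // P π f} := by
    simp only [Nat.card_eq_fintype_card, Fintype.card_subtype]
    exact Finset.sum_card_bipartiteAbove_eq_sum_card_bipartiteBelow P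
  have hfiber : ∀ s : Sym A n, ∑ f with valueMultiset f = s, Nat.card {π // P π f} =
      if s.map σ = s then n.factorial else 0 := by
    intro s
    obtain ⟨f₀, rfl⟩ := valueMultiset_surjective s
    split_ifs with hs
    · have h1 : ∀ f ∈ ({f | valueMultiset f = valueMultiset f₀} : Finset (Fin n → A)),
          Nat.card {π // P π f} = Nat.card {π : Equiv.Perm (Fin n) // f₀ ∘ π = f} := by
        intro f hf
        exact card_perm_semiconj hs (by simpa using hf)
      rw [Finset.sum_congr rfl h1, Finset.sum_filter_of_ne, ← Nat.card_sigma,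
        Nat.card_congr (Equiv.sigmaFiberEquiv _), Nat.card_perm, Nat.card_fin]
      intro f _ hf
      obtain ⟨⟨π, hπ⟩⟩ := (Nat.card_ne_zero.1 hf).1
      rw [← hπ, valueMultiset_comp_perm]
    · refine Finset.sum_eq_zero fun f hf => ?_
      have hf' : valueMultiset f = valueMultiset f₀ := by simpa using hf
      have : IsEmpty {π // P π f} := by
        refine ⟨fun π => hs ?_⟩
        rw [← hf', map_valueMultiset, ← valueMultiset_comp_perm f π.1]
        exact congrArg valueMultiset (funext fun i => (π.2 i).symm)
      exact Nat.card_of_isEmpty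
  change ∑ π, Nat.card {f // P π f} = _
  rw [hswap, ← Finset.sum_fiberwise univ valueMultiset]
  simp only [hfiber]
  rw [← Finset.sum_filter, Finset.sum_const, smul_eq_mul, mul_comm, Nat.card_eq_fintype_card,
    Fintype.card_subtype]

end Counting

section InvariantMultisets

variable {B : Type*} {d : ℕ} [NeZero d]

theorem count_product_univ [DecidableEq B] (t : Multiset B) (p : B × ZMod d) :
    (t ×ˢ (univ : Finset (ZMod d)).val).count p = t.count p.1 := by
  obtain ⟨a, k⟩ := p
  induction t using Multiset.induction_on with
  | empty => simp
  | cons b t ih =>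
    rw [Multiset.cons_product, Multiset.count_add, ih, Multiset.count_cons, add_comm]
    congr 1
    split_ifs with h
    · subst h
      rw [Multiset.count_map_eq_count' _ _ (Prod.mk_right_injective _)]
      exact Multiset.count_eq_one_of_mem (Finset.nodup _) (Finset.mem_univ k)
    · rw [Multiset.count_eq_zero]
      intro hm
      obtain ⟨x, -, hx⟩ := Multiset.mem_map.1 hm
      exact h (Prod.ext_iff.1 hx).1.symm

/-- A multiset on `B × ZMod d` is invariant under translation of the second coordinate if and only
if it is the product of a multiset on `B` with all of `ZMod d`. -/
theorem card_sym_invariant [Finite B] (m : ℕ) :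
    Nat.card {s : Sym (B × ZMod d) (m * d) // s.map (fun a => (a.1, a.2 + 1)) = s} =
      Nat.card (Sym B m) := by
  classical
  have := Fintype.ofFinite B
  have hinj : Function.Injective fun a : B × ZMod d => (a.1, a.2 + 1) := by
    rintro ⟨a, k⟩ ⟨a', k'⟩ h
    simpa using h
  have hinv : ∀ s : Multiset (B × ZMod d), s.map (fun a => (a.1, a.2 + 1)) = s ↔
      ∀ a k, s.count (a, k + 1) = s.count (a, k) := by
    intro s
    constructor
    · intro h a k
      conv_lhs => rw [← h]
      exact Multiset.count_map_eq_count' _ s hinj (a, k)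
    · intro h
      ext ⟨a, k⟩
      have h1 := Multiset.count_map_eq_count' _ s hinj (a, k - 1)
      have h2 := h a (k - 1)
      simp only [sub_add_cancel] at h1 h2
      rw [h1, h2]
  symm
  refine Nat.card_congr (Equiv.ofBijective
    (fun t => ⟨⟨t.1 ×ˢ (univ : Finset (ZMod d)).val, ?_⟩, Subtype.ext ((hinv _).2 ?_)⟩) ⟨?_, ?_⟩)
  · rw [Multiset.card_product, t.2]
    simp [ZMod.card]
  · intro a k
    change Multiset.count _ (t.1 ×ˢ _) = Multiset.count _ (t.1 ×ˢ _)
    rw [count_product_univ, count_product_univ]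
  · intro t t' h
    apply Subtype.ext
    ext a
    have h1 := congrArg (fun s => Multiset.count (a, (0 : ZMod d)) s.1.1) h
    simpa only [count_product_univ] using h1
  · rintro ⟨⟨s, hs⟩, h⟩
    have h1 := (hinv s).1 (congrArg Subtype.val h)
    have h2 : ∀ a k, s.count (a, k) = s.count (a, 0) := by
      intro a k
      rw [← ZMod.natCast_zmod_val k]
      induction k.val with
      | zero => simp
      | succ j ih => rw [Nat.cast_succ, h1, ih]
    let t : Multiset B := ∑ b : B, Multiset.replicate (s.count (b, 0)) b
    have ht : ∀ a, t.count a = s.count (a, 0) := by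
      intro a
      simp [t, Multiset.count_sum', Multiset.count_replicate]
    have hts : t ×ˢ (univ : Finset (ZMod d)).val = s := by
      ext ⟨a, k⟩
      rw [count_product_univ, ht, h2 a k]
    have hcard : Multiset.card t = m := by
      have h3 := congrArg Multiset.card hts
      rw [Multiset.card_product, hs] at h3
      refine Nat.eq_of_mul_eq_mul_right (NeZero.pos d) (Eq.trans ?_ h3)
      simp [ZMod.card]
    exact ⟨⟨t, hcard⟩, Subtype.ext (Subtype.ext hts)⟩

end InvariantMultisets

/-- The permutations of `n` points all of whose cycle lengths are divisible by `d`, weighted by `n`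
to the number of cycles: for each of them, the weight is the number of functions to
`Fin (n / d) × ZMod d` that turn it into translation of the second coordinate. -/
theorem sum_pow_card_parts {n d : ℕ} [NeZero n] (hd : d ∣ n) :
    (∑ π : Equiv.Perm (Fin n), if d ∣ π.partition.parts.gcd then
      n ^ Multiset.card π.partition.parts else 0) =
      n.factorial * (2 * (n / d) - 1).choose (n / d) := by
  obtain ⟨m, hm⟩ := hd
  have hn := NeZero.pos n
  have hd0 : 0 < d := Nat.pos_of_ne_zero (by rintro rfl; omega)
  have : NeZero d := ⟨hd0.ne'⟩
  have hm' : n = m * d := by rw [hm, mul_comm]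
  have hdiv : n / d = m := by rw [hm, Nat.mul_div_cancel_left _ hd0]
  have h := sum_card_semiconj (n := n) (fun a : Fin m × ZMod d => (a.1, a.2 + 1))
  simp only [Equiv.Perm.card_semiconj_prod, Nat.card_fin, ← hm'] at h
  have hinv := card_sym_invariant (B := Fin m) (d := d) m
  rw [← hm'] at hinv
  rw [h, hinv, hdiv, Nat.card_eq_fintype_card, Sym.card_sym_eq_choose, Fintype.card_fin, ← two_mul]

/-! ### The number of orbits -/

open ArithmeticFunction in
theorem sum_divisors_moebius (n : ℕ) : ∑ d ∈ n.divisors, moebius d = if n = 1 then 1 else 0 := by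
  rw [← coe_mul_zeta_apply, moebius_mul_coe_zeta, one_apply]

theorem sum_divisors_even {M : Type*} [AddCommMonoid M] (h : ℕ) (f : ℕ → M) :
    (∑ d ∈ (2 * h).divisors, if 2 ∣ d then f (d / 2) else 0) = ∑ e ∈ h.divisors, f e := by
  rcases Nat.eq_zero_or_pos h with rfl | hh
  · simp
  rw [← Finset.sum_filter]
  symm
  refine Finset.sum_bij' (fun e _ => 2 * e) (fun d _ => d / 2) ?_ ?_ ?_ ?_ ?_
  · intro e he
    have := Nat.dvd_of_mem_divisors he
    simp only [Finset.mem_filter, Nat.mem_divisors]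
    exact ⟨⟨Nat.mul_dvd_mul_left 2 this, by omega⟩, dvd_mul_right 2 e⟩
  · intro d hd
    simp only [Finset.mem_filter, Nat.mem_divisors] at hd
    obtain ⟨⟨h1, -⟩, k, rfl⟩ := hd
    rw [Nat.mul_div_cancel_left _ two_pos]
    exact Nat.mem_divisors.2 ⟨Nat.dvd_of_mul_dvd_mul_left two_pos h1, hh.ne'⟩
  · intro e _
    exact Nat.mul_div_cancel_left e two_pos
  · intro d hd
    exact Nat.mul_div_cancel' (Finset.mem_filter.1 hd).2
  · intro e _
    rw [Nat.mul_div_cancel_left e two_pos]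

/-- The sign `(-1) ^ (n + n / d)` differs from `1` only for `n ≡ 2` modulo `4` and even `d`, up to
those `d` for which `μ d = 0`. -/
theorem neg_one_pow_mul_moebius {n d : ℕ} (hd : d ∣ n) :
    (-1) ^ (n + n / d) * ArithmeticFunction.moebius d = ArithmeticFunction.moebius d +
      if n ≡ 2 [MOD 4] then 2 * (if 2 ∣ d then ArithmeticFunction.moebius (d / 2) else 0)
      else 0 := by
  obtain ⟨k, rfl⟩ := hd
  rcases Nat.eq_zero_or_pos d with rfl | hd0
  · simp
  rw [Nat.mul_div_cancel_left _ hd0]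
  rcases Nat.even_or_odd d with hd | hd
  · obtain ⟨e, he⟩ := hd
    obtain rfl : d = 2 * e := by omega
    have h2 : (2 * e) / 2 = e := Nat.mul_div_cancel_left e two_pos
    have heven : Even (2 * e * k) := ((even_two_mul e).mul_right k)
    rw [pow_add, heven.neg_one_pow, one_mul, if_pos (dvd_mul_right 2 e), h2]
    rcases Nat.even_or_odd k with hk | hk
    · have hmod : ¬ 2 * e * k ≡ 2 [MOD 4] := by
        obtain ⟨j, rfl⟩ := hk
        rw [Nat.ModEq, show 2 * e * (j + j) = 4 * (e * j) by ring]
        omega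
      rw [if_neg hmod, hk.neg_one_pow]
      ring
    · rw [hk.neg_one_pow]
      rcases Nat.even_or_odd e with he | he
      · have hmod : ¬ 2 * e * k ≡ 2 [MOD 4] := by
          obtain ⟨j, rfl⟩ := he
          rw [Nat.ModEq, show 2 * (j + j) * k = 4 * (j * k) by ring]
          omega
        have hsq : ¬ Squarefree (2 * e) := by
          obtain ⟨j, rfl⟩ := he
          intro h
          have h3 := h 2 ⟨j, by ring⟩
          simp at h3
        rw [if_neg hmod, ArithmeticFunction.moebius_eq_zero_of_not_squarefree hsq]
        simp
      · have hmod : 2 * e * k ≡ 2 [MOD 4] := by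
          have h3 := he.mul hk
          rw [Nat.odd_iff] at h3
          rw [Nat.ModEq, mul_assoc]
          omega
        have hmu : ArithmeticFunction.moebius (2 * e) = -ArithmeticFunction.moebius e := by
          rw [ArithmeticFunction.isMultiplicative_moebius.map_mul_of_coprime
            (Nat.coprime_two_left.2 he), ArithmeticFunction.moebius_apply_prime Nat.prime_two]
          ring
        rw [if_pos hmod, hmu]
        ring
  · have h2 : ¬ 2 ∣ d := by
      rw [Nat.two_dvd_ne_zero]
      exact Nat.odd_iff.1 hd
    have heven : Even (d * k + k) := by
      rw [← Nat.succ_mul]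
      exact hd.add_one.mul_right k
    rw [if_neg h2, heven.neg_one_pow]
    simp

/-- The weights of the character, expressed by divisibility of the greatest common divisor `g` of
the cycle lengths. -/
theorem sum_divisors_neg_one_pow {n g : ℕ} [NeZero n] (hg : g ∣ n) :
    (∑ d ∈ n.divisors, if d ∣ g then (-1) ^ (n + n / d) * ArithmeticFunction.moebius d else 0) =
      if g = 1 then 1 else if g = 2 ∧ n ≡ 2 [MOD 4] then 2 else 0 := by
  have hg0 : g ≠ 0 := by
    rintro rfl
    exact NeZero.ne n (zero_dvd_iff.1 hg)
  have hdiv : n.divisors.filter (· ∣ g) = g.divisors := by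
    ext d
    simp only [Finset.mem_filter, Nat.mem_divisors]
    exact ⟨fun h => ⟨h.2, hg0⟩, fun h => ⟨⟨h.1.trans hg, NeZero.ne n⟩, h.1⟩⟩
  rw [← Finset.sum_filter, hdiv, Finset.sum_congr rfl fun d hd =>
    neg_one_pow_mul_moebius ((Nat.dvd_of_mem_divisors hd).trans hg), Finset.sum_add_distrib,
    sum_divisors_moebius]
  have heven : (∑ d ∈ g.divisors, if 2 ∣ d then ArithmeticFunction.moebius (d / 2) else 0) =
      if g = 2 then 1 else 0 := by
    by_cases h2 : 2 ∣ g
    · obtain ⟨h, rfl⟩ := h2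
      rw [sum_divisors_even, sum_divisors_moebius]
      exact if_congr (by omega) rfl rfl
    · rw [if_neg (by rintro rfl; exact h2 dvd_rfl)]
      refine Finset.sum_eq_zero fun d hd => if_neg fun h => h2 ?_
      exact h.trans (Nat.dvd_of_mem_divisors hd)
  by_cases hn : n ≡ 2 [MOD 4]
  · simp only [hn, if_true, and_true]
    rw [← Finset.mul_sum, heven]
    split_ifs <;> omega
  · simp [hn]

namespace ExtParkingFunction

theorem orbitCount_mul_factorial (n c : ℕ) [NeZero n] :
    orbitCount n c * n.factorial = ∑ π : Equiv.Perm (Fin n),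
      Nat.card (MulAction.fixedBy (ExtParkingFunction n c) (MulOpposite.op π)) := by
  classical
  have : Fintype (ExtParkingFunction n c) := Fintype.ofFinite _
  have : Fintype (MulAction.orbitRel.Quotient (Equiv.Perm (Fin n))ᵐᵒᵖ (ExtParkingFunction n c)) :=
    Fintype.ofFinite _
  have : Fintype (Equiv.Perm (Fin n))ᵐᵒᵖ := Fintype.ofEquiv _ MulOpposite.opEquiv
  have h := MulAction.sum_card_fixedBy_eq_card_orbits_mul_card_group
    (Equiv.Perm (Fin n))ᵐᵒᵖ (ExtParkingFunction n c)
  have hcard : Fintype.card (Equiv.Perm (Fin n))ᵐᵒᵖ = n.factorial := by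
    rw [← Fintype.card_congr MulOpposite.opEquiv, Fintype.card_perm, Fintype.card_fin]
  rw [hcard, ← Equiv.sum_comp MulOpposite.opEquiv] at h
  simp only [← Nat.card_eq_fintype_card] at h
  exact h.symm

theorem sq_mul_orbitCount (n : ℕ) [NeZero n] :
    (n : ℤ) ^ 2 * orbitCount n 1 = ∑ d ∈ n.divisors,
      (-1) ^ (n + n / d) * ArithmeticFunction.moebius d *
        ((2 * (n / d) - 1).choose (n / d) : ℕ) := by
  have hfact : (n.factorial : ℤ) ≠ 0 := Nat.cast_ne_zero.2 (Nat.factorial_ne_zero n)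
  have hfix : ∀ π : Equiv.Perm (Fin n),
      (n : ℤ) ^ 2 * Nat.card (MulAction.fixedBy (ExtParkingFunction n 1) (MulOpposite.op π)) =
        ∑ d ∈ n.divisors, (-1) ^ (n + n / d) * ArithmeticFunction.moebius d *
          (if d ∣ π.partition.parts.gcd then n ^ Multiset.card π.partition.parts else 0 : ℕ) := by
    intro π
    have h1 := congrArg (Nat.cast (R := ℤ)) (sq_mul_card_fixedBy π)
    rw [Nat.cast_mul, Nat.cast_pow] at h1
    have h2 := congrArg (· * (n : ℤ) ^ Multiset.card π.partition.parts)
      (sum_divisors_neg_one_pow (Equiv.Perm.gcd_partition_parts_dvd π))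
    rw [Finset.sum_mul] at h2
    refine h1.trans (Eq.trans ?_ (h2.symm.trans ?_))
    · split_ifs <;> simp
    · refine Finset.sum_congr rfl fun d _ => ?_
      split_ifs <;> simp
  have hburnside := congrArg (Nat.cast (R := ℤ)) (orbitCount_mul_factorial n 1)
  push_cast at hburnside
  refine mul_left_cancel₀ hfact ?_
  calc (n.factorial : ℤ) * ((n : ℤ) ^ 2 * orbitCount n 1)
      = (n : ℤ) ^ 2 * (orbitCount n 1 * n.factorial) := by ring
    _ = _ := by
      rw [hburnside, Finset.mul_sum, Finset.sum_congr rfl fun π _ => hfix π, Finset.sum_comm,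
        Finset.mul_sum]
      refine Finset.sum_congr rfl fun d hd => ?_
      rw [← Finset.mul_sum, ← Nat.cast_sum, sum_pow_card_parts (Nat.dvd_of_mem_divisors hd)]
      push_cast
      ring

theorem orbitCount_one_eq (n : ℕ) [NeZero n] :
    (orbitCount n 1 : ℚ) = 1 / (n : ℚ) ^ 2 * ∑ d ∈ n.divisors,
      (-1) ^ (n + d) * (ArithmeticFunction.moebius (n / d) : ℚ) * ((2 * d - 1).choose d : ℚ) := by
  have hn : (n : ℚ) ^ 2 ≠ 0 := pow_ne_zero 2 (NeZero.ne _)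
  have h := congrArg (Int.cast (R := ℚ)) (sq_mul_orbitCount n)
  rw [← Nat.sum_div_divisors]
  have hsum : (∑ d ∈ n.divisors, (-1) ^ (n + n / d) *
      (ArithmeticFunction.moebius (n / (n / d)) : ℚ) * ((2 * (n / d) - 1).choose (n / d) : ℚ)) =
      (n : ℚ) ^ 2 * orbitCount n 1 := by
    push_cast at h
    rw [h]
    refine Finset.sum_congr rfl fun d hd => ?_
    rw [Nat.div_div_self (Nat.dvd_of_mem_divisors hd) (NeZero.ne n)]
  rw [hsum, ← mul_assoc, one_div, inv_mul_cancel₀ hn, one_mul]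

end ExtParkingFunction

theorem theorem3p2 (n : ℕ) [NeZero n] :
    (∀ π : Equiv.Perm (Fin n),
      ExtParkingFunction.character n 1 π =
        if π.partition.parts.gcd = 1 then
          (n : ℂ) ^ ((Multiset.card π.partition.parts : ℤ) - 2)
        else if π.partition.parts.gcd = 2 ∧ n ≡ 2 [MOD 4] then
          2 * (n : ℂ) ^ ((Multiset.card π.partition.parts : ℤ) - 2)
        else 0) ∧
    (ExtParkingFunction.orbitCount n 1 : ℚ) =
      1 / (n : ℚ) ^ 2 * ∑ d ∈ n.divisors,
        (-1) ^ (n + d) * (ArithmeticFunction.moebius (n / d) : ℚ) * ((2 * d - 1).choose d : ℚ) :=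
  ⟨ExtParkingFunction.character_one_eq, ExtParkingFunction.orbitCount_one_eq n⟩
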